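/- Let $T>0$, $B_0>0$, and let $\lambda_0,\mu:[0,T]\to[0,\infty)$ be measurable with $\lambda_0\le B_0$ almost everywhere and $c_\mu:=\int_0^T\mu(t)\,dt<1$. A random event sequence $0<t_1<\dots<t_{N_e}\le T$ (with $N_e<\infty$) is called a linear Hawkes process on $[0,T]$ with background intensity $\lambda_0$ and excitation function $\mu$ if its conditional intensity with respect to its own history is $$\lambda^*(t)=\lambda_0(t)+\sum_{j:\,t_j<t}\mu(t-t_j),\qquad t\in[0,T];$$ that is, with $N(t)=\#\{j:t_j\le t\}$ and $\mathcal H_t=\sigma(N(s):s\le t)$, the process $N(t)-\int_0^t\lambda^*(u)\,du$ stopped at the $k$-th event is an $(\mathcal H_t)$-martingale on $[0,T]$ for every $k\in\mathbb N$. Let $\eta$ be any number with $\eta>1$ and $c_\mu\eta<1$ (i.e. $\eta\in(1,1/c_\mu)$, with $1/0=\infty$). Then: (1) Let $n\ge1$, $\delta\in(0,1)$, let $S_1,\dots,S_n$ be linear Hawkes processes as above on one probability space (in particular, $n$ independent ones; independence is not needed), let $N_{ei}$ be the number of events of $S_i$, $N_{e(n)}=\max_{1\le i\le n}N_{ei}$,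 and $$M=\frac{1}{1-c_\mu\eta}\left(\frac{2}{\log\eta}\log\left(\frac{2n\sqrt{B_0T}}{\delta(1-c_\mu)}\right)+\eta B_0T\right).$$ If $M>0$, then $N_{e(n)}<M$ with probability at least $1-\delta$; if $M\le0$, then $N_{e(n)}=0$ with probability at least $1-\delta$. (2) The number of events $N_e$ of one such process satisfies, for every integer $s\ge1$, $$\mathbb P(N_e=s)\le\mathbb P(N_e\ge s)\le\frac{2\sqrt{B_0T}}{1-c_\mu}\exp\left(\frac{\log\eta}{2}\bigl[\eta B_0T-(1-c_\mu\eta)s\bigr]\right).$$ (3) Consequently, for any fixed $\eta_0>1$ with $c_\mu\eta_0<1$, with $a_N=\frac{2\sqrt{B_0T}}{1-c_\mu}\exp\left(\tfrac12\log(\eta_0)\,\eta_0B_0T\right)$ and $c_N=\tfrac12\log(\eta_0)(1-c_\mu\eta_0)$, we have $\mathbb P(N_e=s)\le\mathbb P(N_e\ge s)\le a_Ne^{-c_Ns}$ for every integer $s\ge1$. -/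

import Mathlib

open MeasureTheory Set
open scoped ENNReal

/-- A random event time sequence `0 < t_1 < ... < t_N ≤ T` on `[0, T]` with a finite random number
`N` of events. The `(j+1)`-st event time is `time j`; it is only meaningful for `j < count ω`. -/
structure EventSequence (T : ℝ) (Ω : Type*) [MeasurableSpace Ω] where
  /-- the total number of events on `[0, T]` -/
  count : Ω → ℕ
  /-- the event times, enumerated from `0` -/
  time : ℕ → Ω → ℝ
  measurable_count : Measurable count
  measurable_time : ∀ j, Measurable (time j)
  time_pos : ∀ ω j, j < count ω → 0 < time j ω
  time_le : ∀ ω j, j < count ω → time j ω ≤ T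
  time_lt : ∀ ω i j, i < j → j < count ω → time i ω < time j ω

namespace EventSequence

variable {T : ℝ} {Ω : Type*} [MeasurableSpace Ω] (S : EventSequence T Ω)

/-- The counting process `N(t) = #{j : t_j ≤ t}`. -/
noncomputable def countUpTo (t : ℝ) (ω : Ω) : ℕ :=
  ((Finset.range (S.count ω)).filter (fun j => S.time j ω ≤ t)).card

/-- The left limit `N(t-) = #{j : t_j < t}` of the counting process. -/
noncomputable def countBefore (t : ℝ) (ω : Ω) : ℕ :=
  ((Finset.range (S.count ω)).filter (fun j => S.time j ω < t)).card

/-- The number of events among the first `k` ones that fall in `(a, b]`, which is the increment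
over `(a, b]` of the counting process stopped at its `k`-th event,
`min (N(b)) k - min (N(a)) k`. -/
noncomputable def countFirst (k : ℕ) (a b : ℝ) (ω : Ω) : ℕ :=
  ((Finset.range (S.count ω)).filter
    (fun j => j < k ∧ a < S.time j ω ∧ S.time j ω ≤ b)).card

/-- The history `σ(N(s) : s ≤ t)` of the counting process. -/
@[reducible] noncomputable def history (t : ℝ) : MeasurableSpace Ω :=
  ⨆ s ∈ Iic t, MeasurableSpace.comap (S.countUpTo s) ⊤

/-- The nonnegative process `lam` is the conditional intensity of the event sequence with respect
to its own history: for each `k` the counting process stopped at the `k`-th event, minus the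
integral of `lam` up to that stopping time, is a martingale, i.e.
`E[N(a, b] | H_a] = E[∫_a^b lam(u) du | H_a]` for all `0 ≤ a ≤ b ≤ T`, up to localization along
the event times (`u` is not later than the `k`-th event iff `N(u-) < k`). Here
`E[X | H_a] = E[Y | H_a]` is expressed by equality of the integrals of `X` and `Y` over all sets
of `H_a`. -/
def HasIntensity (P : Measure Ω) (lam : ℝ → Ω → ℝ) : Prop :=
  ∀ (k : ℕ) (a b : ℝ), 0 ≤ a → a ≤ b → b ≤ T →
    ∀ A : Set Ω, MeasurableSet[S.history a] A →
      ∫⁻ ω in A, (S.countFirst k a b ω : ℝ≥0∞) ∂P =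
        ∫⁻ ω in A, (∫⁻ u in {u : ℝ | u ∈ Ioc a b ∧ S.countBefore u ω < k},
          ENNReal.ofReal (lam u ω) ∂volume) ∂P

/-- The self-exciting intensity `lam0(t) + ∑_{j : t_j < t} mu(t - t_j)`. -/
noncomputable def hawkesIntensity (lam0 mu : ℝ → ℝ) (t : ℝ) (ω : Ω) : ℝ :=
  lam0 t + ∑ j ∈ (Finset.range (S.count ω)).filter (fun j => S.time j ω < t),
    mu (t - S.time j ω)

/-- The event sequence is a linear Hawkes (self-exciting) process on `[0, T]` with background
intensity `lam0` and excitation function `mu`. -/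
def IsLinearHawkes (P : Measure Ω) (lam0 mu : ℝ → ℝ) : Prop :=
  S.HasIntensity P (S.hawkesIntensity lam0 mu)

end EventSequence

/-! The engine is an exponential supermartingale. Stop the count at its `k`-th event. Before
stopping, the intensity is at most `B` plus a sum over the first `k` event times. Its integral is
therefore dominated by a continuous nondecreasing process `G`, with `G(T) ≤ B * T + k * c`, where
`c` is the mass of the excitation. Then `Z_t = η ^ N_k(t) * exp (-(η - 1) * G(t))` satisfies `E Z_T
≤ 1` (`integral_expFunctional_le_one`). No stochastic calculus enters: the increment of `Z` is
bounded pathwise by left-endpoint sums of compensated increments, which have nonpositive mean, plus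
an error that vanishes as the grid is refined (`eventually_expFunctional_sub_le`).

If at least `k` events occur, `Z_T` is at least `η ^ k * exp (-(η - 1) * (B * T + k * c))`. Markov's
inequality then gives exponential decay in `k` (`measureReal_le_count_le_exp`). A first-moment bound
for the first event gives `(1 - c) * P(N ≥ 1) ≤ B * T` (`measureReal_one_le_count_le`). The
geometric mean of the two bounds produces the prefactor with `√(B * T)` and halves the exponent. The
maximum over `n` sequences follows by a union bound. -/

open Filter Topology

namespace EventSequence

/-! ### Event times, stopped counts and the history -/

section Basic

variable {T : ℝ} {Ω : Type*} [MeasurableSpace Ω] (S : EventSequence T Ω)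

/-- The time of the `(j+1)`-st event, with the value `T + 1` if there is no such event. -/
noncomputable def eventTime (j : ℕ) (ω : Ω) : ℝ :=
  if j < S.count ω then S.time j ω else T + 1

/-- The counting process stopped at its `k`-th event. -/
noncomputable def stoppedCount (k : ℕ) (t : ℝ) (ω : Ω) : ℕ :=
  ((Finset.range k).filter (fun j => S.eventTime j ω ≤ t)).card

lemma eventTime_of_lt {j : ℕ} {ω : Ω} (h : j < S.count ω) :
    S.eventTime j ω = S.time j ω := if_pos h

lemma eventTime_of_le {j : ℕ} {ω : Ω} (h : S.count ω ≤ j) :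
    S.eventTime j ω = T + 1 := if_neg h.not_gt

lemma eventTime_le_iff {j : ℕ} {ω : Ω} {t : ℝ} (ht : t ≤ T) :
    S.eventTime j ω ≤ t ↔ j < S.count ω ∧ S.time j ω ≤ t := by
  by_cases h : j < S.count ω
  · simp [S.eventTime_of_lt h, h]
  · simp only [S.eventTime_of_le (not_lt.1 h), h, false_and, iff_false, not_le]
    linarith

lemma eventTime_pos (hT : 0 < T) (j : ℕ) (ω : Ω) : 0 < S.eventTime j ω := by
  by_cases h : j < S.count ω
  · rw [S.eventTime_of_lt h]
    exact S.time_pos ω j h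
  · rw [S.eventTime_of_le (not_lt.1 h)]
    linarith

lemma measurable_eventTime (j : ℕ) : Measurable (S.eventTime j) :=
  Measurable.ite (S.measurable_count measurableSet_Ioi) (S.measurable_time j) measurable_const

lemma time_le_time {ω : Ω} {i j : ℕ} (hij : i ≤ j) (hj : j < S.count ω) :
    S.time i ω ≤ S.time j ω := by
  rcases hij.eq_or_lt with rfl | h
  · exact le_rfl
  · exact (S.time_lt ω i j h hj).le

/-- Event times increase, so the events up to `t` have an initial segment of indices. This turns
statements about event times into statements about the counts that generate the history. -/
lemma eventTime_le_iff_lt_countUpTo {j : ℕ} {ω : Ω} {t : ℝ} (ht : t ≤ T) :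
    S.eventTime j ω ≤ t ↔ j < S.countUpTo t ω := by
  rw [S.eventTime_le_iff ht]
  constructor
  · rintro ⟨hj, hjt⟩
    have hsub : Finset.range (j + 1) ⊆
        (Finset.range (S.count ω)).filter (fun j => S.time j ω ≤ t) := by
      intro i hi
      have hi' : i ≤ j := Nat.lt_succ_iff.1 (Finset.mem_range.1 hi)
      exact Finset.mem_filter.2 ⟨Finset.mem_range.2 (hi'.trans_lt hj),
        (S.time_le_time hi' hj).trans hjt⟩
    have := Finset.card_le_card hsub
    rw [Finset.card_range] at this
    exact this
  · intro h
    by_contra hcon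
    have hsub : (Finset.range (S.count ω)).filter (fun j => S.time j ω ≤ t) ⊆
        Finset.range j := by
      intro i hi
      obtain ⟨hi1, hi2⟩ := Finset.mem_filter.1 hi
      rw [Finset.mem_range] at hi1 ⊢
      by_contra hij
      have hji := not_lt.1 hij
      exact hcon ⟨hji.trans_lt hi1, (S.time_le_time hji hi1).trans hi2⟩
    have := Finset.card_le_card hsub
    rw [Finset.card_range] at this
    exact absurd h (not_lt.2 this)

lemma lt_of_time_lt_of_countBefore_lt {j k : ℕ} {ω : Ω} {t : ℝ} (hj : j < S.count ω)
    (hjt : S.time j ω < t) (hk : S.countBefore t ω < k) : j < k := by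
  have hsub : Finset.range (j + 1) ⊆
      (Finset.range (S.count ω)).filter (fun j => S.time j ω < t) := by
    intro i hi
    have hi' : i ≤ j := Nat.lt_succ_iff.1 (Finset.mem_range.1 hi)
    exact Finset.mem_filter.2 ⟨Finset.mem_range.2 (hi'.trans_lt hj),
      (S.time_le_time hi' hj).trans_lt hjt⟩
  have := Finset.card_le_card hsub
  rw [Finset.card_range] at this
  unfold countBefore at hk
  omega

lemma history_le (t : ℝ) (ht : t ≤ T) : S.history t ≤ ‹MeasurableSpace Ω› := by
  refine iSup₂_le fun s hs => Measurable.comap_le ?_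
  refine measurable_of_Ioi fun j => ?_
  have heq : S.countUpTo s ⁻¹' Ioi j = S.eventTime j ⁻¹' Iic s := by
    ext ω
    exact (S.eventTime_le_iff_lt_countUpTo (le_trans hs ht)).symm
  rw [heq]
  exact S.measurable_eventTime j measurableSet_Iic

lemma measurableSet_history_eventTime_le {s t : ℝ} (hst : s ≤ t) (ht : t ≤ T) (j : ℕ) :
    MeasurableSet[S.history t] {ω | S.eventTime j ω ≤ s} := by
  have heq : {ω | S.eventTime j ω ≤ s} = S.countUpTo s ⁻¹' Ioi j := by
    ext ω
    exact S.eventTime_le_iff_lt_countUpTo (hst.trans ht)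
  rw [heq]
  have hle : MeasurableSpace.comap (S.countUpTo s) ⊤ ≤ S.history t :=
    le_iSup₂_of_le s hst le_rfl
  exact hle _ ⟨Ioi j, trivial, rfl⟩

/-- An event time beyond `t` is unknown at time `t`, but its truncation at `t` is known. -/
lemma measurable_history_min_eventTime {t : ℝ} (ht : t ≤ T) (j : ℕ) :
    Measurable[S.history t] fun ω => min (S.eventTime j ω) t := by
  refine measurable_of_Iic fun s => ?_
  by_cases hst : t ≤ s
  · have : (fun ω => min (S.eventTime j ω) t) ⁻¹' Iic s = univ := by
      ext ω
      simp [hst]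
    rw [this]
    exact @MeasurableSet.univ _ (S.history t)
  · have : (fun ω => min (S.eventTime j ω) t) ⁻¹' Iic s = {ω | S.eventTime j ω ≤ s} := by
      ext ω
      simp [hst]
    rw [this]
    exact S.measurableSet_history_eventTime_le (not_le.1 hst).le ht j

lemma stoppedCount_eq_sum (k : ℕ) (t : ℝ) :
    S.stoppedCount k t =
      fun ω => ∑ j ∈ Finset.range k, {ω | S.eventTime j ω ≤ t}.indicator (fun _ => 1) ω := by
  ext ω
  simp only [stoppedCount, indicator_apply, mem_ofPred_eq, Finset.sum_boole, Nat.cast_id]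

lemma measurable_history_stoppedCount (k : ℕ) {t : ℝ} (ht : t ≤ T) :
    Measurable[S.history t] (S.stoppedCount k t) := by
  rw [stoppedCount_eq_sum]
  refine @Finset.measurable_fun_sum _ _ _ _ _ _ (S.history t) _ _ fun j _ => ?_
  exact (@measurable_const _ _ _ (S.history t) 1).indicator
    (S.measurableSet_history_eventTime_le le_rfl ht j)

lemma stoppedCount_add_countFirst (k : ℕ) {a b : ℝ} (hab : a ≤ b) (hb : b ≤ T) (ω : Ω) :
    S.stoppedCount k a ω + S.countFirst k a b ω = S.stoppedCount k b ω := by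
  unfold stoppedCount countFirst
  rw [← Finset.card_union_of_disjoint]
  · congr 1
    ext j
    simp only [Finset.mem_union, Finset.mem_filter, Finset.mem_range, S.eventTime_le_iff hb,
      S.eventTime_le_iff (hab.trans hb)]
    constructor
    · rintro (⟨h1, h2, h3⟩ | ⟨h1, h2, h3, h4⟩)
      · exact ⟨h1, h2, h3.trans hab⟩
      · exact ⟨h2, h1, h4⟩
    · rintro ⟨h1, h2, h3⟩
      by_cases h : S.time j ω ≤ a
      · exact Or.inl ⟨h1, h2, h⟩
      · exact Or.inr ⟨h2, h1, not_le.1 h, h3⟩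
  · rw [Finset.disjoint_left]
    intro j h1 h2
    simp only [Finset.mem_filter, Finset.mem_range, S.eventTime_le_iff (hab.trans hb)] at h1 h2
    exact absurd h1.2.2 (not_le.2 h2.2.2.1)

lemma stoppedCount_le (k : ℕ) (t : ℝ) (ω : Ω) : S.stoppedCount k t ω ≤ k :=
  (Finset.card_filter_le _ _).trans (Finset.card_range k).le

lemma stoppedCount_zero (hT : 0 < T) (k : ℕ) (ω : Ω) : S.stoppedCount k 0 ω = 0 := by
  simp only [stoppedCount, Finset.card_eq_zero, Finset.filter_eq_empty_iff, not_le]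
  exact fun j _ => S.eventTime_pos hT j ω

lemma stoppedCount_of_le_count {k : ℕ} {ω : Ω} (hk : k ≤ S.count ω) :
    S.stoppedCount k T ω = k := by
  unfold stoppedCount
  rw [Finset.filter_true_of_mem, Finset.card_range]
  intro j hj
  have hj' := (Finset.mem_range.1 hj).trans_le hk
  exact (S.eventTime_le_iff le_rfl).2 ⟨hj', S.time_le ω j hj'⟩

/-- Finitely many distinct times have a positive minimal gap. It depends on `ω`, so the grid
argument is run path by path. -/
lemma exists_gap (k : ℕ) (ω : Ω) :
    ∃ h > 0, ∀ a b : ℝ, b - a ≤ h → S.countFirst k a b ω ≤ 1 := by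
  have hev : ∀ᶠ h : ℝ in 𝓝[>] 0, ∀ i ∈ Finset.range (S.count ω),
      ∀ j ∈ Finset.range (S.count ω), i < j → h < S.time j ω - S.time i ω := by
    refine (Finset.eventually_all _).2 fun i _ => (Finset.eventually_all _).2 fun j hj => ?_
    by_cases hij : i < j
    · have hpos := sub_pos.2 (S.time_lt ω i j hij (Finset.mem_range.1 hj))
      filter_upwards [mem_nhdsWithin_of_mem_nhds (Iio_mem_nhds hpos)] with h hh _ using hh
    · exact Eventually.of_forall fun h h' => absurd h' hij
  obtain ⟨h, hh, hpos⟩ := (hev.and self_mem_nhdsWithin).exists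
  refine ⟨h, hpos, fun a b hab => Finset.card_le_one.2 fun i hi j hj => ?_⟩
  obtain ⟨hi1, -, hi2, hi3⟩ := Finset.mem_filter.1 hi
  obtain ⟨hj1, -, hj2, hj3⟩ := Finset.mem_filter.1 hj
  rcases lt_trichotomy i j with hij | hij | hij
  · have := hh i hi1 j hj1 hij
    linarith
  · exact hij
  · have := hh j hj1 i hi1 hij
    linarith

end Basic

end EventSequence

/-! ### Pathwise estimates for the exponential functional on a grid -/

lemma Real.exp_neg_le_one_sub_add_sq {y : ℝ} (hy : 0 ≤ y) : Real.exp (-y) ≤ 1 - y + y ^ 2 := by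
  have h1 : 1 + y ≤ Real.exp y := by linarith [Real.add_one_le_exp y]
  rw [Real.exp_neg, inv_le_iff_one_le_mul₀ (Real.exp_pos y)]
  have h2 : 0 ≤ 1 - y + y ^ 2 := by nlinarith [sq_nonneg (y - 1)]
  have h3 : 0 ≤ y ^ 3 := by positivity
  -- `(1 - y + y ^ 2) * (1 + y) = 1 + y ^ 3`.
  nlinarith [mul_le_mul_of_nonneg_left h1 h2]

/-- The exponential functional `η ^ n * exp (-(η - 1) * x)` of a count `n` and a compensator
`x`. -/
noncomputable def expFunctional (η : ℝ) (n : ℕ) (x : ℝ) : ℝ :=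
  η ^ n * Real.exp (-((η - 1) * x))

lemma expFunctional_nonneg {η : ℝ} (hη : 1 < η) (n : ℕ) (x : ℝ) : 0 ≤ expFunctional η n x := by
  unfold expFunctional
  positivity

lemma expFunctional_le {η : ℝ} (hη : 1 < η) {n k : ℕ} (hn : n ≤ k) {x : ℝ} (hx : 0 ≤ x) :
    expFunctional η n x ≤ η ^ k := by
  have h1 : η ^ n ≤ η ^ k := pow_le_pow_right₀ hη.le hn
  have h2 : Real.exp (-((η - 1) * x)) ≤ 1 :=
    Real.exp_le_one_iff.2 (neg_nonpos.2 (mul_nonneg (by linarith) hx))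
  exact (mul_le_of_le_one_right (by positivity) h2).trans h1

/-- This is a first-order expansion over a step with at most one event. A jump multiplies the
functional by `η`, which accounts for the factor `η - 1` on the count; the exponential contributes
the same factor on the compensator, up to a quadratic error. -/
lemma expFunctional_sub_le {η : ℝ} (hη : 1 < η) {n m k : ℕ} (hnm : n ≤ m) (hmn : m ≤ n + 1)
    (hm : m ≤ k) {x y : ℝ} (hx : 0 ≤ x) (hxy : x ≤ y) :
    expFunctional η m y - expFunctional η n x ≤
      (η - 1) * (expFunctional η n x * ((m : ℝ) - n - (y - x))) +
        η ^ k * (η - 1) ^ 2 * (y - x) ^ 2 := by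
  have hz : 0 ≤ (η - 1) * (y - x) := mul_nonneg (by linarith) (by linarith)
  have hE : Real.exp (-((η - 1) * y)) ≤ Real.exp (-((η - 1) * x)) *
      (1 - (η - 1) * (y - x) + ((η - 1) * (y - x)) ^ 2) := by
    have : -((η - 1) * y) = -((η - 1) * x) + -((η - 1) * (y - x)) := by ring
    rw [this, Real.exp_add]
    exact mul_le_mul_of_nonneg_left (Real.exp_neg_le_one_sub_add_sq hz) (Real.exp_pos _).le
  have hstep : expFunctional η m y ≤ expFunctional η m x *
      (1 - (η - 1) * (y - x) + ((η - 1) * (y - x)) ^ 2) := by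
    unfold expFunctional
    rw [mul_assoc]
    exact mul_le_mul_of_nonneg_left hE (by positivity)
  have herr : expFunctional η m x * ((η - 1) * (y - x)) ^ 2 ≤
      η ^ k * (η - 1) ^ 2 * (y - x) ^ 2 := by
    rw [mul_assoc, ← mul_pow]
    exact mul_le_mul_of_nonneg_right (expFunctional_le hη hm hx) (sq_nonneg _)
  have h0 := expFunctional_nonneg hη n x
  obtain rfl | rfl : m = n ∨ m = n + 1 := by omega
  · nlinarith
  · have hs : expFunctional η (n + 1) x = η * expFunctional η n x := by
      unfold expFunctional
      ring
    rw [hs] at hstep herr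
    push_cast
    -- After a jump the linear decrease carries an extra factor `η ≥ 1`; dropping it only enlarges
    -- the bound.
    nlinarith [mul_nonneg (mul_nonneg h0 hz) (sub_nonneg.2 hη.le)]

/-- The `i`-th point of the division of `[0, T]` into `n + 1` intervals of equal length. -/
noncomputable def gridPoint (T : ℝ) (n i : ℕ) : ℝ := T * i / (n + 1)

lemma gridPoint_zero (T : ℝ) (n : ℕ) : gridPoint T n 0 = 0 := by simp [gridPoint]

lemma gridPoint_last (T : ℝ) (n : ℕ) : gridPoint T n (n + 1) = T := by
  have : (n : ℝ) + 1 ≠ 0 := by positivity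
  simp [gridPoint, this]

lemma gridPoint_nonneg {T : ℝ} (hT : 0 ≤ T) (n i : ℕ) : 0 ≤ gridPoint T n i := by
  unfold gridPoint
  positivity

lemma gridPoint_succ_sub (T : ℝ) (n i : ℕ) :
    gridPoint T n (i + 1) - gridPoint T n i = T / (n + 1) := by
  unfold gridPoint
  push_cast
  ring

lemma gridPoint_le_succ {T : ℝ} (hT : 0 ≤ T) (n i : ℕ) :
    gridPoint T n i ≤ gridPoint T n (i + 1) := by
  have h := gridPoint_succ_sub T n i
  have : 0 ≤ T / ((n : ℝ) + 1) := by positivity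
  linarith

lemma gridPoint_le {T : ℝ} (hT : 0 ≤ T) {n i : ℕ} (hi : i ≤ n + 1) : gridPoint T n i ≤ T := by
  have h : (i : ℝ) ≤ n + 1 := by exact_mod_cast hi
  unfold gridPoint
  rw [div_le_iff₀ (by positivity)]
  exact mul_le_mul_of_nonneg_left h hT

/-- The one-step bounds telescope. The quadratic errors sum to at most a constant times the largest
increment of `G` times `G T`, which is small by uniform continuity. -/
lemma eventually_expFunctional_sub_le {η T : ℝ} (hη : 1 < η) (hT : 0 < T) {k : ℕ} {N : ℝ → ℕ}
    {G : ℝ → ℝ} (hGc : Continuous G) (hGm : Monotone G) (hG0 : G 0 = 0) (hNk : ∀ t, N t ≤ k)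
    (hN : ∃ h > 0, ∀ a b, a ≤ b → b ≤ T → b - a ≤ h → N a ≤ N b ∧ N b ≤ N a + 1)
    {ε : ℝ} (hε : 0 < ε) :
    ∀ᶠ n : ℕ in atTop, expFunctional η (N T) (G T) - expFunctional η (N 0) (G 0) ≤
      (η - 1) * ∑ i ∈ Finset.range (n + 1),
        expFunctional η (N (gridPoint T n i)) (G (gridPoint T n i)) *
          ((N (gridPoint T n (i + 1)) : ℝ) - N (gridPoint T n i) -
            (G (gridPoint T n (i + 1)) - G (gridPoint T n i))) + ε := by
  obtain ⟨h, hh, hjump⟩ := hN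
  have hGT : 0 ≤ G T := hG0 ▸ hGm hT.le
  set C := η ^ k * (η - 1) ^ 2 with hC
  have hC0 : 0 ≤ C := by positivity
  -- This bound on the increments of `G` makes the total error at most `ε`; the `+ 1` covers `C * G
  -- T = 0`.
  have hε' : 0 < ε / (C * G T + 1) := by positivity
  have huc : UniformContinuousOn G (Icc 0 T) :=
    isCompact_Icc.uniformContinuousOn_of_continuous hGc.continuousOn
  obtain ⟨d, hd, hdG⟩ := Metric.uniformContinuousOn_iff.1 huc _ hε'
  have hlim : Tendsto (fun n : ℕ => T / ((n : ℝ) + 1)) atTop (𝓝 0) := by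
    have := (tendsto_one_div_add_atTop_nhds_zero_nat (𝕜 := ℝ)).const_mul T
    simpa [div_eq_mul_inv] using this
  filter_upwards [hlim.eventually (Iio_mem_nhds (lt_min hh hd))] with n hn
  have hn' : T / ((n : ℝ) + 1) < min h d := hn
  have hsum : ∀ i ∈ Finset.range (n + 1),
      expFunctional η (N (gridPoint T n (i + 1))) (G (gridPoint T n (i + 1))) -
        expFunctional η (N (gridPoint T n i)) (G (gridPoint T n i)) ≤
      (η - 1) * (expFunctional η (N (gridPoint T n i)) (G (gridPoint T n i)) *
          ((N (gridPoint T n (i + 1)) : ℝ) - N (gridPoint T n i) -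
            (G (gridPoint T n (i + 1)) - G (gridPoint T n i)))) +
        C * (ε / (C * G T + 1)) * (G (gridPoint T n (i + 1)) - G (gridPoint T n i)) := by
    intro i hi
    have hi' := Finset.mem_range.1 hi
    have hle := gridPoint_le_succ hT.le n i
    have hsub := gridPoint_succ_sub T n i
    have h0 := gridPoint_nonneg hT.le n i
    have hT' : gridPoint T n (i + 1) ≤ T := gridPoint_le hT.le hi'
    have hj := hjump _ _ hle hT' (hsub.le.trans (hn'.trans_le (min_le_left _ _)).le)
    have hG := hGm hle
    have hGsmall : G (gridPoint T n (i + 1)) - G (gridPoint T n i) ≤ ε / (C * G T + 1) := by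
      have := hdG _ ⟨h0.trans hle, hT'⟩ _ ⟨h0, hle.trans hT'⟩ (by
        rw [Real.dist_eq, hsub, abs_of_nonneg (by positivity)]
        exact hn'.trans_le (min_le_right _ _))
      exact (le_abs_self _).trans this.le
    have hstep := expFunctional_sub_le hη hj.1 hj.2 (hNk _) (hG0 ▸ hGm h0) hG
    have hsq : C * (G (gridPoint T n (i + 1)) - G (gridPoint T n i)) ^ 2 ≤
        C * (ε / (C * G T + 1)) * (G (gridPoint T n (i + 1)) - G (gridPoint T n i)) := by
      rw [sq, mul_assoc C]
      exact mul_le_mul_of_nonneg_left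
        (mul_le_mul_of_nonneg_right hGsmall (sub_nonneg.2 hG)) hC0
    linarith
  have htot := Finset.sum_le_sum hsum
  rw [Finset.sum_range_sub (fun i => expFunctional η (N (gridPoint T n i)) (G (gridPoint T n i))),
    Finset.sum_add_distrib, ← Finset.mul_sum, ← Finset.mul_sum,
    Finset.sum_range_sub (fun i => G (gridPoint T n i)), gridPoint_zero, gridPoint_last, hG0,
    sub_zero] at htot
  have hlast : C * (ε / (C * G T + 1)) * G T ≤ ε := by
    have : C * (ε / (C * G T + 1)) * G T = ε * (C * G T) / (C * G T + 1) := by ring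
    rw [this, div_le_iff₀ (by positivity)]
    nlinarith
  rw [hG0]
  linarith

/-! ### The dominating compensator -/

lemma monotone_primitive_of_nonneg {g : ℝ → ℝ} (hg0 : ∀ t, 0 ≤ g t) (hgi : Integrable g) :
    Monotone fun r => ∫ u in (0 : ℝ)..r, g u := by
  intro a b hab
  have h := intervalIntegral.integral_interval_sub_left (hgi.intervalIntegrable (a := 0) (b := b))
    (hgi.intervalIntegrable (a := 0) (b := a))
  have h2 : 0 ≤ ∫ u in a..b, g u := intervalIntegral.integral_nonneg hab fun u _ => hg0 u
  simp only
  linarith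

lemma primitive_le_integral {g : ℝ → ℝ} (hg0 : ∀ t, 0 ≤ g t) (hgi : Integrable g) (r : ℝ) :
    ∫ u in (0 : ℝ)..r, g u ≤ ∫ u, g u := by
  rcases le_total 0 r with hr | hr
  · rw [intervalIntegral.integral_of_le hr]
    exact setIntegral_le_integral hgi (Eventually.of_forall hg0)
  · calc ∫ u in (0 : ℝ)..r, g u ≤ ∫ u in (0 : ℝ)..0, g u :=
          monotone_primitive_of_nonneg hg0 hgi hr
      _ = 0 := intervalIntegral.integral_same
      _ ≤ _ := integral_nonneg hg0

/-- Events not yet reached contribute nothing, so `compensatorBound` can sum over all `j < k` and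
still depend only on the past. -/
lemma primitive_eq_zero_of_nonpos {g : ℝ → ℝ} (hgneg : ∀ t < 0, g t = 0) {r : ℝ} (hr : r ≤ 0) :
    ∫ u in (0 : ℝ)..r, g u = 0 := by
  rw [intervalIntegral.integral_symm, intervalIntegral.integral_of_le hr,
    integral_Ioc_eq_integral_Ioo,
    setIntegral_eq_zero_of_forall_eq_zero fun u hu => hgneg u hu.2, neg_zero]

namespace EventSequence

variable {T : ℝ} {Ω : Type*} [MeasurableSpace Ω] (S : EventSequence T Ω)

/-- An upper bound of the compensator of the event sequence stopped at its `k`-th event, for a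
background intensity bounded by `B` and an excitation function bounded by `g`. -/
noncomputable def compensatorBound (B : ℝ) (g : ℝ → ℝ) (k : ℕ) (t : ℝ) (ω : Ω) : ℝ :=
  B * t + ∑ j ∈ Finset.range k, ∫ u in (0 : ℝ)..(t - S.eventTime j ω), g u

lemma monotone_compensatorBound {B : ℝ} (hB : 0 ≤ B) {g : ℝ → ℝ} (hg0 : ∀ t, 0 ≤ g t)
    (hgi : Integrable g) (k : ℕ) (ω : Ω) : Monotone fun t => S.compensatorBound B g k t ω := by
  intro a b hab
  exact add_le_add (mul_le_mul_of_nonneg_left hab hB) (Finset.sum_le_sum fun j _ =>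
    monotone_primitive_of_nonneg hg0 hgi (sub_le_sub_right hab _))

lemma continuous_compensatorBound (B : ℝ) {g : ℝ → ℝ} (hgi : Integrable g) (k : ℕ) (ω : Ω) :
    Continuous fun t => S.compensatorBound B g k t ω := by
  have h : Continuous fun r => ∫ u in (0 : ℝ)..r, g u :=
    intervalIntegral.continuous_primitive (fun _ _ => hgi.intervalIntegrable) 0
  unfold compensatorBound
  exact (continuous_const.mul continuous_id).add (continuous_finsetSum _ fun j _ =>
    h.comp (continuous_id.sub continuous_const))

lemma compensatorBound_zero (hT : 0 < T) (B : ℝ) {g : ℝ → ℝ} (hgneg : ∀ t < 0, g t = 0)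
    (k : ℕ) (ω : Ω) : S.compensatorBound B g k 0 ω = 0 := by
  unfold compensatorBound
  rw [mul_zero, zero_add]
  refine Finset.sum_eq_zero fun j _ => primitive_eq_zero_of_nonpos hgneg ?_
  linarith [S.eventTime_pos hT j ω]

lemma compensatorBound_le (B : ℝ) {g : ℝ → ℝ} (hg0 : ∀ t, 0 ≤ g t) (hgi : Integrable g)
    (k : ℕ) (t : ℝ) (ω : Ω) : S.compensatorBound B g k t ω ≤ B * t + k * ∫ u, g u := by
  unfold compensatorBound
  gcongr
  calc _ ≤ ∑ j ∈ Finset.range k, ∫ u, g u :=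
        Finset.sum_le_sum fun j _ => primitive_le_integral hg0 hgi _
    _ = _ := by simp

lemma measurable_history_compensatorBound (B : ℝ) {g : ℝ → ℝ} (hgi : Integrable g)
    (hgneg : ∀ t < 0, g t = 0) (k : ℕ) {t : ℝ} (ht : t ≤ T) :
    Measurable[S.history t] (S.compensatorBound B g k t) := by
  have h : Continuous fun r => ∫ u in (0 : ℝ)..r, g u :=
    intervalIntegral.continuous_primitive (fun _ _ => hgi.intervalIntegrable) 0
  have heq : S.compensatorBound B g k t = fun ω => B * t + ∑ j ∈ Finset.range k,
      ∫ u in (0 : ℝ)..(t - min (S.eventTime j ω) t), g u := by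
    ext ω
    unfold compensatorBound
    congr 1
    refine Finset.sum_congr rfl fun j _ => ?_
    rcases le_total (S.eventTime j ω) t with hj | hj
    · rw [min_eq_left hj]
    · rw [min_eq_right hj, sub_self, intervalIntegral.integral_same]
      exact primitive_eq_zero_of_nonpos hgneg (by linarith)
  rw [heq]
  refine Measurable.const_add (Finset.measurable_fun_sum _ fun j _ => ?_) _
  exact h.measurable.comp ((S.measurable_history_min_eventTime ht j).const_sub t)

lemma compensatorBound_sub (B : ℝ) {g : ℝ → ℝ} (hgi : Integrable g) (k : ℕ) {a b : ℝ}
    (hab : a ≤ b) (ω : Ω) :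
    S.compensatorBound B g k b ω - S.compensatorBound B g k a ω =
      ∫ u in Ioc a b, (B + ∑ j ∈ Finset.range k, g (u - S.eventTime j ω)) := by
  rw [← intervalIntegral.integral_of_le hab, intervalIntegral.integral_add
    intervalIntegrable_const
    (integrable_finsetSum _ fun j _ => hgi.comp_sub_right _).intervalIntegrable,
    intervalIntegral.integral_const, intervalIntegral.integral_finsetSum
    fun j _ => (hgi.comp_sub_right _).intervalIntegrable]
  have h : ∀ j ∈ Finset.range k, ∫ u in a..b, g (u - S.eventTime j ω) =
      (∫ u in (0 : ℝ)..(b - S.eventTime j ω), g u) -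
        ∫ u in (0 : ℝ)..(a - S.eventTime j ω), g u := by
    intro j _
    rw [intervalIntegral.integral_comp_sub_right, intervalIntegral.integral_interval_sub_left
      hgi.intervalIntegrable hgi.intervalIntegrable]
  rw [Finset.sum_congr rfl h, Finset.sum_sub_distrib, smul_eq_mul]
  unfold compensatorBound
  ring

/-- When fewer than `k` events precede `u`, all of them have index below `k`; the remaining terms on
the right are nonnegative. -/
lemma hawkesIntensity_le {B : ℝ} {lam0 mu g : ℝ → ℝ} (hg0 : ∀ t, 0 ≤ g t)
    (hmug : ∀ t ∈ Icc 0 T, mu t ≤ g t) {k : ℕ} {u : ℝ} (hu : u ≤ T) (hlam : lam0 u ≤ B) {ω : Ω}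
    (hk : S.countBefore u ω < k) :
    S.hawkesIntensity lam0 mu u ω ≤ B + ∑ j ∈ Finset.range k, g (u - S.eventTime j ω) := by
  unfold hawkesIntensity
  refine add_le_add hlam ?_
  calc ∑ j ∈ (Finset.range (S.count ω)).filter (fun j => S.time j ω < u), mu (u - S.time j ω)
      ≤ ∑ j ∈ (Finset.range (S.count ω)).filter (fun j => S.time j ω < u),
          g (u - S.eventTime j ω) := by
        refine Finset.sum_le_sum fun j hj => ?_
        obtain ⟨hj1, hj2⟩ := Finset.mem_filter.1 hj
        have hj1 := Finset.mem_range.1 hj1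
        rw [S.eventTime_of_lt hj1]
        exact hmug _ ⟨by linarith, by linarith [S.time_pos ω j hj1]⟩
    _ ≤ _ := by
        refine Finset.sum_le_sum_of_subset_of_nonneg (fun j hj => ?_) fun j _ _ => hg0 _
        obtain ⟨hj1, hj2⟩ := Finset.mem_filter.1 hj
        exact Finset.mem_range.2
          (S.lt_of_time_lt_of_countBefore_lt (Finset.mem_range.1 hj1) hj2 hk)

lemma lintegral_hawkesIntensity_le {B : ℝ} (hB : 0 ≤ B) {lam0 mu g : ℝ → ℝ}
    (hlam : ∀ᵐ t ∂(volume.restrict (Icc 0 T)), lam0 t ≤ B) (hg0 : ∀ t, 0 ≤ g t)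
    (hgi : Integrable g) (hmug : ∀ t ∈ Icc 0 T, mu t ≤ g t) (k : ℕ) {a b : ℝ} (ha : 0 ≤ a)
    (hab : a ≤ b) (hb : b ≤ T) (ω : Ω) :
    ∫⁻ u in {u : ℝ | u ∈ Ioc a b ∧ S.countBefore u ω < k},
        ENNReal.ofReal (S.hawkesIntensity lam0 mu u ω) ≤
      ENNReal.ofReal (S.compensatorBound B g k b ω - S.compensatorBound B g k a ω) := by
  have hint : IntegrableOn (fun u => B + ∑ j ∈ Finset.range k, g (u - S.eventTime j ω))
      (Ioc a b) :=
    (integrableOn_const (by simp)).add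
      (integrable_finsetSum _ fun j _ => (hgi.comp_sub_right _).integrableOn)
  rw [S.compensatorBound_sub B hgi k hab, ofReal_integral_eq_lintegral_ofReal hint
    (Eventually.of_forall fun u => add_nonneg hB (Finset.sum_nonneg fun j _ => hg0 _))]
  have hsub : {u : ℝ | u ∈ Ioc a b ∧ S.countBefore u ω < k} ⊆ Ioc a b := fun u hu => hu.1
  refine le_trans (setLIntegral_mono_ae
    (hint.mono_set hsub).aestronglyMeasurable.aemeasurable.ennreal_ofReal ?_)
    (lintegral_mono_set hsub)
  filter_upwards [(ae_restrict_iff' measurableSet_Icc).1 hlam] with u hu hmem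
  exact ENNReal.ofReal_le_ofReal (S.hawkesIntensity_le hg0 hmug (hmem.1.2.trans hb)
    (hu ⟨ha.trans hmem.1.1.le, hmem.1.2.trans hb⟩) hmem.2)

end EventSequence

/-! ### The supermartingale inequality and its tail bounds -/

namespace EventSequence

variable {T : ℝ} {Ω : Type*} [MeasurableSpace Ω] (S : EventSequence T Ω)

lemma measurable_stoppedCount (k : ℕ) {t : ℝ} (ht : t ≤ T) : Measurable (S.stoppedCount k t) :=
  (S.measurable_history_stoppedCount k ht).mono (S.history_le t ht) le_rfl

lemma measurable_compensatorBound (B : ℝ) {g : ℝ → ℝ} (hgi : Integrable g)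
    (hgneg : ∀ t < 0, g t = 0) (k : ℕ) {t : ℝ} (ht : t ≤ T) :
    Measurable (S.compensatorBound B g k t) :=
  (S.measurable_history_compensatorBound B hgi hgneg k ht).mono (S.history_le t ht) le_rfl

lemma countFirst_eq_sub (k : ℕ) {a b : ℝ} (hab : a ≤ b) (hb : b ≤ T) (ω : Ω) :
    (S.countFirst k a b ω : ℝ) = S.stoppedCount k b ω - S.stoppedCount k a ω := by
  rw [← S.stoppedCount_add_countFirst k hab hb]
  push_cast
  ring

lemma measurable_countFirst (k : ℕ) {a b : ℝ} (hab : a ≤ b) (hb : b ≤ T) :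
    Measurable (S.countFirst k a b) := by
  have : S.countFirst k a b = fun ω => S.stoppedCount k b ω - S.stoppedCount k a ω := by
    ext ω
    rw [← S.stoppedCount_add_countFirst k hab hb, Nat.add_sub_cancel_left]
  rw [this]
  exact (S.measurable_stoppedCount k hb).sub (S.measurable_stoppedCount k (hab.trans hb))

variable {P : Measure Ω} {B : ℝ} {lam0 mu g : ℝ → ℝ}

/-- The intensity property tests only against sets of the history. Read as an inequality between two
measures with densities, trimmed to the history, it extends to every nonnegative measurable weight
known at time `a`. -/
lemma IsLinearHawkes.lintegral_countFirst_le {S : EventSequence T Ω}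
    (hS : S.IsLinearHawkes P lam0 mu) (hB : 0 ≤ B)
    (hlam : ∀ᵐ t ∂(volume.restrict (Icc 0 T)), lam0 t ≤ B) (hg0 : ∀ t, 0 ≤ g t)
    (hgi : Integrable g) (hgneg : ∀ t < 0, g t = 0) (hmug : ∀ t ∈ Icc 0 T, mu t ≤ g t) (k : ℕ)
    {a b : ℝ} (ha : 0 ≤ a) (hab : a ≤ b) (hb : b ≤ T) {Z : Ω → ℝ≥0∞}
    (hZ : Measurable[S.history a] Z) :
    ∫⁻ ω, (S.countFirst k a b ω : ℝ≥0∞) * Z ω ∂P ≤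
      ∫⁻ ω, ENNReal.ofReal (S.compensatorBound B g k b ω - S.compensatorBound B g k a ω) *
        Z ω ∂P := by
  have hle := S.history_le a (hab.trans hb)
  have hC : Measurable fun ω => (S.countFirst k a b ω : ℝ≥0∞) :=
    (measurable_from_top (f := fun n : ℕ => (n : ℝ≥0∞))).comp (S.measurable_countFirst k hab hb)
  have hG : Measurable fun ω => ENNReal.ofReal
      (S.compensatorBound B g k b ω - S.compensatorBound B g k a ω) :=
    ((S.measurable_compensatorBound B hgi hgneg k hb).sub
      (S.measurable_compensatorBound B hgi hgneg k (hab.trans hb))).ennreal_ofReal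
  have hmeas : (P.withDensity fun ω => (S.countFirst k a b ω : ℝ≥0∞)).trim hle ≤
      (P.withDensity fun ω => ENNReal.ofReal
        (S.compensatorBound B g k b ω - S.compensatorBound B g k a ω)).trim hle := by
    refine Measure.le_iff.2 fun A hA => ?_
    rw [trim_measurableSet_eq hle hA, trim_measurableSet_eq hle hA,
      withDensity_apply _ (hle A hA), withDensity_apply _ (hle A hA), hS k a b ha hab hb A hA]
    exact lintegral_mono fun ω =>
      S.lintegral_hawkesIntensity_le hB hlam hg0 hgi hmug k ha hab hb ω
  have hZ' : Measurable Z := hZ.mono hle le_rfl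
  have h := lintegral_mono' hmeas (le_refl Z)
  rwa [lintegral_trim hle hZ, lintegral_trim hle hZ, lintegral_withDensity_eq_lintegral_mul _ hC hZ',
    lintegral_withDensity_eq_lintegral_mul _ hG hZ'] at h

lemma IsLinearHawkes.integral_increment_nonpos [IsProbabilityMeasure P] {S : EventSequence T Ω}
    (hS : S.IsLinearHawkes P lam0 mu) (hT : 0 < T) (hB : 0 ≤ B)
    (hlam : ∀ᵐ t ∂(volume.restrict (Icc 0 T)), lam0 t ≤ B) (hg0 : ∀ t, 0 ≤ g t)
    (hgi : Integrable g) (hgneg : ∀ t < 0, g t = 0) (hmug : ∀ t ∈ Icc 0 T, mu t ≤ g t) (k : ℕ)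
    {a b : ℝ} (ha : 0 ≤ a) (hab : a ≤ b) (hb : b ≤ T) {Z : Ω → ℝ}
    (hZ : Measurable[S.history a] Z) (hZ0 : ∀ ω, 0 ≤ Z ω) {K : ℝ} (hZK : ∀ ω, Z ω ≤ K) :
    Integrable (fun ω => Z ω * ((S.stoppedCount k b ω : ℝ) - S.stoppedCount k a ω -
      (S.compensatorBound B g k b ω - S.compensatorBound B g k a ω))) P ∧
    ∫ ω, Z ω * ((S.stoppedCount k b ω : ℝ) - S.stoppedCount k a ω -
      (S.compensatorBound B g k b ω - S.compensatorBound B g k a ω)) ∂P ≤ 0 := by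
  have hle := S.history_le a (hab.trans hb)
  have hZ' : Measurable Z := hZ.mono hle le_rfl
  have hC : Measurable fun ω => (S.countFirst k a b ω : ℝ) :=
    (measurable_from_top (f := fun n : ℕ => (n : ℝ))).comp (S.measurable_countFirst k hab hb)
  have hG : Measurable fun ω => S.compensatorBound B g k b ω - S.compensatorBound B g k a ω :=
    (S.measurable_compensatorBound B hgi hgneg k hb).sub
      (S.measurable_compensatorBound B hgi hgneg k (hab.trans hb))
  have hG0 : ∀ ω, 0 ≤ S.compensatorBound B g k b ω - S.compensatorBound B g k a ω := fun ω =>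
    sub_nonneg.2 (S.monotone_compensatorBound hB hg0 hgi k ω hab)
  have hGK : ∀ ω, S.compensatorBound B g k b ω - S.compensatorBound B g k a ω ≤
      B * b + k * ∫ u, g u := fun ω => by
    have h1 := S.compensatorBound_le B hg0 hgi k b ω
    have h2 := S.monotone_compensatorBound hB hg0 hgi k ω ha
    simp only [S.compensatorBound_zero hT B hgneg k ω] at h2
    linarith
  have hCk : ∀ ω, (S.countFirst k a b ω : ℝ) ≤ k := fun ω => by
    have h1 := S.stoppedCount_add_countFirst k hab hb ω
    have h2 := S.stoppedCount_le k b ω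
    exact_mod_cast (by omega : S.countFirst k a b ω ≤ k)
  have hi1 : Integrable (fun ω => (S.countFirst k a b ω : ℝ) * Z ω) P := by
    refine Integrable.of_bound (hC.mul hZ').aestronglyMeasurable (k * K)
      (Eventually.of_forall fun ω => ?_)
    rw [Real.norm_of_nonneg (mul_nonneg (Nat.cast_nonneg _) (hZ0 ω))]
    exact mul_le_mul (hCk ω) (hZK ω) (hZ0 ω) (Nat.cast_nonneg _)
  have hi2 : Integrable (fun ω => (S.compensatorBound B g k b ω -
      S.compensatorBound B g k a ω) * Z ω) P := by
    refine Integrable.of_bound (hG.mul hZ').aestronglyMeasurable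
      ((B * b + k * ∫ u, g u) * K) (Eventually.of_forall fun ω => ?_)
    rw [Real.norm_of_nonneg (mul_nonneg (hG0 ω) (hZ0 ω))]
    exact mul_le_mul (hGK ω) (hZK ω) (hZ0 ω) ((hG0 ω).trans (hGK ω))
  have heq : (fun ω => Z ω * ((S.stoppedCount k b ω : ℝ) - S.stoppedCount k a ω -
      (S.compensatorBound B g k b ω - S.compensatorBound B g k a ω))) =
      fun ω => (S.countFirst k a b ω : ℝ) * Z ω -
        (S.compensatorBound B g k b ω - S.compensatorBound B g k a ω) * Z ω := by
    ext ω
    rw [S.countFirst_eq_sub k hab hb]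
    ring
  rw [heq]
  refine ⟨hi1.sub hi2, ?_⟩
  rw [integral_sub hi1 hi2, sub_nonpos,
    ← ENNReal.ofReal_le_ofReal_iff (integral_nonneg fun ω => mul_nonneg (hG0 ω) (hZ0 ω)),
    ofReal_integral_eq_lintegral_ofReal hi1
      (Eventually.of_forall fun ω => mul_nonneg (Nat.cast_nonneg _) (hZ0 ω)),
    ofReal_integral_eq_lintegral_ofReal hi2
      (Eventually.of_forall fun ω => mul_nonneg (hG0 ω) (hZ0 ω))]
  simp_rw [ENNReal.ofReal_mul (Nat.cast_nonneg _), ENNReal.ofReal_mul (hG0 _),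
    ENNReal.ofReal_natCast]
  exact hS.lintegral_countFirst_le hB hlam hg0 hgi hgneg hmug k ha hab hb hZ.ennreal_ofReal

/-- The grid sums `D n` have nonpositive mean, so `E Z_T - 1` is at most the mean of the positive
part `W n` of the discretization error. That mean tends to zero by dominated convergence. -/
lemma IsLinearHawkes.integral_expFunctional_le_one [IsProbabilityMeasure P]
    {S : EventSequence T Ω} (hS : S.IsLinearHawkes P lam0 mu) (hT : 0 < T) (hB : 0 ≤ B)
    (hlam : ∀ᵐ t ∂(volume.restrict (Icc 0 T)), lam0 t ≤ B) (hg0 : ∀ t, 0 ≤ g t)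
    (hgi : Integrable g) (hgneg : ∀ t < 0, g t = 0) (hmug : ∀ t ∈ Icc 0 T, mu t ≤ g t) (k : ℕ)
    {η : ℝ} (hη : 1 < η) :
    Integrable (fun ω => expFunctional η (S.stoppedCount k T ω)
      (S.compensatorBound B g k T ω)) P ∧
    ∫ ω, expFunctional η (S.stoppedCount k T ω) (S.compensatorBound B g k T ω) ∂P ≤ 1 := by
  set Z : ℝ → Ω → ℝ := fun t ω => expFunctional η (S.stoppedCount k t ω)
    (S.compensatorBound B g k t ω) with hZdef
  have hZmeas : ∀ t ≤ T, Measurable[S.history t] (Z t) := fun t ht =>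
    ((measurable_from_top (f := fun n : ℕ => η ^ n)).comp
      (S.measurable_history_stoppedCount k ht)).mul
      ((S.measurable_history_compensatorBound B hgi hgneg k ht).const_mul (η - 1)).neg.exp
  have hGm := fun ω => S.monotone_compensatorBound hB hg0 hgi k ω
  have hG0 := fun ω => S.compensatorBound_zero hT B hgneg k ω
  have hGnn : ∀ t, 0 ≤ t → ∀ ω, 0 ≤ S.compensatorBound B g k t ω := fun t ht ω =>
    hG0 ω ▸ hGm ω ht
  have hZ0 : ∀ t ω, 0 ≤ Z t ω := fun t ω => expFunctional_nonneg hη _ _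
  have hZK : ∀ t, 0 ≤ t → ∀ ω, Z t ω ≤ η ^ k := fun t ht ω =>
    expFunctional_le hη (S.stoppedCount_le k t ω) (hGnn t ht ω)
  have hZ1 : ∀ ω, Z 0 ω = 1 := fun ω => by
    simp [hZdef, expFunctional, S.stoppedCount_zero hT, hG0 ω]
  have hZT : Integrable (Z T) P := by
    refine Integrable.of_bound ((hZmeas T le_rfl).mono
      (S.history_le T le_rfl) le_rfl).aestronglyMeasurable (η ^ k) (Eventually.of_forall fun ω => ?_)
    rw [Real.norm_of_nonneg (hZ0 T ω)]
    exact hZK T hT.le ω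
  refine ⟨hZT, ?_⟩
  set d : ℕ → ℕ → Ω → ℝ := fun n i ω => Z (gridPoint T n i) ω *
    ((S.stoppedCount k (gridPoint T n (i + 1)) ω : ℝ) - S.stoppedCount k (gridPoint T n i) ω -
      (S.compensatorBound B g k (gridPoint T n (i + 1)) ω -
        S.compensatorBound B g k (gridPoint T n i) ω)) with hd
  set D : ℕ → Ω → ℝ := fun n ω => ∑ i ∈ Finset.range (n + 1), d n i ω with hDdef
  have hdn : ∀ n, ∀ i ∈ Finset.range (n + 1), Integrable (d n i) P ∧ ∫ ω, d n i ω ∂P ≤ 0 := by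
    intro n i hi
    have hi' := Finset.mem_range.1 hi
    exact hS.integral_increment_nonpos hT hB hlam hg0 hgi hgneg hmug k
      (gridPoint_nonneg hT.le n i) (gridPoint_le_succ hT.le n i) (gridPoint_le hT.le hi')
      (hZmeas _ (gridPoint_le hT.le hi'.le)) (hZ0 _) (hZK _ (gridPoint_nonneg hT.le n i))
  have hDi : ∀ n, Integrable (D n) P := fun n =>
    integrable_finsetSum _ fun i hi => (hdn n i hi).1
  have hDle : ∀ n, ∫ ω, D n ω ∂P ≤ 0 := fun n => by
    rw [hDdef, integral_finsetSum _ fun i hi => (hdn n i hi).1]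
    exact Finset.sum_nonpos fun i hi => (hdn n i hi).2
  -- Jumps only raise `D n`, and the compensator increments telescope, so the bound is uniform in
  -- `n` and `ω`. A lower bound suffices to dominate the positive part `W n`.
  have hDlow : ∀ n ω, -(η ^ k * (B * T + k * ∫ u, g u)) ≤ D n ω := by
    intro n ω
    have hterm : ∀ i ∈ Finset.range (n + 1),
        -(η ^ k * (S.compensatorBound B g k (gridPoint T n (i + 1)) ω -
          S.compensatorBound B g k (gridPoint T n i) ω)) ≤ d n i ω := by
      intro i hi
      have hi' := Finset.mem_range.1 hi
      have hN := S.countFirst_eq_sub k (gridPoint_le_succ hT.le n i)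
        (gridPoint_le hT.le hi') ω
      have hN0 : (0 : ℝ) ≤ S.countFirst k (gridPoint T n i) (gridPoint T n (i + 1)) ω :=
        Nat.cast_nonneg _
      have hG := sub_nonneg.2 (hGm ω (gridPoint_le_succ hT.le n i))
      have h1 := mul_le_mul_of_nonneg_right (hZK _ (gridPoint_nonneg hT.le n i) ω) hG
      have h2 := mul_nonneg (hZ0 (gridPoint T n i) ω) hN0
      simp only [hd]
      rw [← hN, mul_sub]
      simp only at h1
      linarith
    have hs := Finset.sum_le_sum hterm
    rw [Finset.sum_neg_distrib, ← Finset.mul_sum,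
      Finset.sum_range_sub (fun i => S.compensatorBound B g k (gridPoint T n i) ω),
      gridPoint_zero, gridPoint_last, hG0, sub_zero] at hs
    refine le_trans (neg_le_neg ?_) hs
    exact mul_le_mul_of_nonneg_left (S.compensatorBound_le B hg0 hgi k T ω) (by positivity)
  set W : ℕ → Ω → ℝ := fun n ω => max 0 (Z T ω - 1 - (η - 1) * D n ω) with hW
  have hWi : ∀ n, Integrable (W n) P := fun n =>
    (integrable_zero _ _ _).sup ((hZT.sub (integrable_const 1)).sub ((hDi n).const_mul (η - 1)))
  have hWlim : Tendsto (fun n => ∫ ω, W n ω ∂P) atTop (𝓝 (∫ _, (0 : ℝ) ∂P)) := by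
    refine tendsto_integral_of_dominated_convergence
      (fun _ => η ^ k + (η - 1) * (η ^ k * (B * T + k * ∫ u, g u)))
      (fun n => (hWi n).aestronglyMeasurable) (integrable_const _)
      (fun n => Eventually.of_forall fun ω => ?_) (Eventually.of_forall fun ω => ?_)
    · rw [Real.norm_of_nonneg (le_max_left _ _)]
      have h1 := mul_le_mul_of_nonneg_left (hDlow n ω) (sub_nonneg.2 hη.le)
      have h2 := hZK T hT.le ω
      have h3 : 0 ≤ ∫ u, g u := integral_nonneg hg0
      have h4 : 0 ≤ (η - 1) * (η ^ k * (B * T + k * ∫ u, g u)) := by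
        have := sub_nonneg.2 hη.le
        positivity
      have h5 : 0 ≤ η ^ k := by positivity
      exact max_le (by linarith) (by linarith)
    · have hN : ∃ h > 0, ∀ a b, a ≤ b → b ≤ T → b - a ≤ h →
          S.stoppedCount k a ω ≤ S.stoppedCount k b ω ∧
            S.stoppedCount k b ω ≤ S.stoppedCount k a ω + 1 := by
        obtain ⟨h, hh, hc⟩ := S.exists_gap k ω
        refine ⟨h, hh, fun a b hab hb hba => ?_⟩
        have h1 := S.stoppedCount_add_countFirst k hab hb ω
        have h2 := hc a b hba
        omega
      rw [Metric.tendsto_nhds]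
      intro ε hε
      filter_upwards [eventually_expFunctional_sub_le hη hT
        (S.continuous_compensatorBound B hgi k ω) (hGm ω) (hG0 ω)
        (fun t => S.stoppedCount_le k t ω) hN (half_pos hε)] with n hn
      have hn' : Z T ω - Z 0 ω ≤ (η - 1) * D n ω + ε / 2 := hn
      rw [hZ1] at hn'
      rw [Real.dist_eq, sub_zero, abs_of_nonneg (le_max_left _ _)]
      exact max_lt hε (by linarith)
  rw [integral_zero] at hWlim
  have hge : ∀ n, ∫ ω, Z T ω ∂P - 1 ≤ ∫ ω, W n ω ∂P := by
    intro n
    have h1 : ∫ ω, (Z T ω - 1 - (η - 1) * D n ω) ∂P ≤ ∫ ω, W n ω ∂P :=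
      integral_mono ((hZT.sub (integrable_const 1)).sub ((hDi n).const_mul (η - 1))) (hWi n)
        fun ω => le_max_right _ _
    have hZT1 : Integrable (fun ω => Z T ω - 1) P := hZT.sub (integrable_const 1)
    rw [integral_sub hZT1 ((hDi n).const_mul (η - 1)), integral_sub hZT (integrable_const 1), integral_const_mul] at h1
    simp only [integral_const, probReal_univ, smul_eq_mul, mul_one] at h1
    have h2 := mul_nonpos_of_nonneg_of_nonpos (sub_nonneg.2 hη.le) (hDle n)
    linarith
  have := ge_of_tendsto' hWlim hge
  linarith

lemma measurableSet_le_count (k : ℕ) : MeasurableSet {ω | k ≤ S.count ω} :=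
  S.measurable_count measurableSet_Ici

/-- Markov's inequality: with at least `k` events the stopped count is exactly `k`, and
`compensatorBound` is at most its deterministic bound. -/
lemma IsLinearHawkes.measureReal_le_count_le_exp [IsProbabilityMeasure P]
    {S : EventSequence T Ω} (hS : S.IsLinearHawkes P lam0 mu) (hT : 0 < T) (hB : 0 ≤ B)
    (hlam : ∀ᵐ t ∂(volume.restrict (Icc 0 T)), lam0 t ≤ B) (hg0 : ∀ t, 0 ≤ g t)
    (hgi : Integrable g) (hgneg : ∀ t < 0, g t = 0) (hmug : ∀ t ∈ Icc 0 T, mu t ≤ g t) (k : ℕ)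
    {η : ℝ} (hη : 1 < η) :
    P.real {ω | k ≤ S.count ω} ≤
      Real.exp ((η - 1) * (B * T + k * ∫ u, g u) - k * Real.log η) := by
  obtain ⟨hi, hle⟩ := hS.integral_expFunctional_le_one hT hB hlam hg0 hgi hgneg hmug k hη
  have hη0 : 0 < η := by linarith
  have hmarkov := mul_meas_ge_le_integral_of_nonneg
    (Eventually.of_forall fun ω => expFunctional_nonneg hη _ _) hi
    (expFunctional η k (B * T + k * ∫ u, g u))
  have hsub : {ω | k ≤ S.count ω} ⊆ {ω | expFunctional η k (B * T + k * ∫ u, g u) ≤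
      expFunctional η (S.stoppedCount k T ω) (S.compensatorBound B g k T ω)} := by
    intro ω hω
    have hω' : k ≤ S.count ω := hω
    have hc := S.compensatorBound_le B hg0 hgi k T ω
    rw [mem_ofPred_eq, S.stoppedCount_of_le_count hω']
    unfold expFunctional
    have h1 := mul_le_mul_of_nonneg_left hc (sub_nonneg.2 hη.le)
    exact mul_le_mul_of_nonneg_left (Real.exp_le_exp.2 (neg_le_neg h1)) (by positivity)
  have hmono := measureReal_mono (μ := P) hsub
  have hval : expFunctional η k (B * T + k * ∫ u, g u) =
      Real.exp (-((η - 1) * (B * T + k * ∫ u, g u) - k * Real.log η)) := by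
    have hneg : -((η - 1) * (B * T + k * ∫ u, g u) - k * Real.log η) =
        Real.log η * k + -((η - 1) * (B * T + k * ∫ u, g u)) := by ring
    unfold expFunctional
    rw [hneg, Real.exp_add, Real.exp_mul, Real.exp_log hη0,
      Real.rpow_natCast]
  rw [hval] at hmarkov hmono
  have h := (mul_le_mul_of_nonneg_left hmono (Real.exp_pos _).le).trans (hmarkov.trans hle)
  rw [Real.exp_neg] at h
  exact (inv_mul_le_one₀ (Real.exp_pos _)).1 h

/-- Take `k = 1` and weight `1`: the mean of the count stopped at the first event is at most that of
its compensator bound, which exceeds `B * T` only if an event occurs, and then by at most the mass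
of `g`. -/
lemma IsLinearHawkes.measureReal_one_le_count_le [IsProbabilityMeasure P]
    {S : EventSequence T Ω} (hS : S.IsLinearHawkes P lam0 mu) (hT : 0 < T) (hB : 0 ≤ B)
    (hlam : ∀ᵐ t ∂(volume.restrict (Icc 0 T)), lam0 t ≤ B) (hg0 : ∀ t, 0 ≤ g t)
    (hgi : Integrable g) (hgneg : ∀ t < 0, g t = 0) (hmug : ∀ t ∈ Icc 0 T, mu t ≤ g t) :
    (1 - ∫ u, g u) * P.real {ω | 1 ≤ S.count ω} ≤ B * T := by
  obtain ⟨hi, hle⟩ := hS.integral_increment_nonpos hT hB hlam hg0 hgi hgneg hmug 1 le_rfl hT.le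
    le_rfl (Z := fun _ => 1) measurable_const (fun _ => zero_le_one) (K := 1) (fun _ => le_rfl)
  have hmeas := S.measurableSet_le_count 1
  have hpt : ∀ ω, (1 - ∫ u, g u) * {ω | 1 ≤ S.count ω}.indicator 1 ω - B * T ≤
      1 * ((S.stoppedCount 1 T ω : ℝ) - S.stoppedCount 1 0 ω -
        (S.compensatorBound B g 1 T ω - S.compensatorBound B g 1 0 ω)) := by
    intro ω
    rw [S.stoppedCount_zero hT, S.compensatorBound_zero hT B hgneg]
    by_cases hω : 1 ≤ S.count ω
    · have h1 := S.compensatorBound_le B hg0 hgi 1 T ω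
      have hmem : ω ∈ {ω | 1 ≤ S.count ω} := hω
      rw [S.stoppedCount_of_le_count hω, indicator_of_mem hmem]
      push_cast at h1 ⊢
      simp only [Pi.one_apply]
      linarith
    · have hnot : ω ∉ {ω | 1 ≤ S.count ω} := hω
      -- The default event time `T + 1` lies beyond the horizon, so the primitive vanishes.
      have h0 : S.compensatorBound B g 1 T ω = B * T := by
        unfold compensatorBound
        rw [Finset.sum_range_one, S.eventTime_of_le (by omega),
          primitive_eq_zero_of_nonpos hgneg (by linarith), add_zero]
      rw [indicator_of_notMem hnot, h0]
      have : (0 : ℝ) ≤ S.stoppedCount 1 T ω := Nat.cast_nonneg _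
      push_cast
      linarith
  have hI : Integrable ({ω | 1 ≤ S.count ω}.indicator (1 : Ω → ℝ)) P :=
    (integrable_const 1).indicator hmeas
  have h := (integral_mono ((hI.const_mul (1 - ∫ u, g u)).sub (integrable_const (B * T))) hi
    hpt).trans hle
  rw [integral_sub' (hI.const_mul _) (integrable_const _), integral_const_mul,
    integral_indicator_one hmeas] at h
  simp only [integral_const, probReal_univ, smul_eq_mul, one_mul] at h
  linarith

end EventSequence

/-! ### Combining the tail bounds -/

lemma exp_sub_one_mul_le {η x c s : ℝ} (hη : 1 < η) (hx : 0 ≤ x) (hc : 0 ≤ c) (hs : 0 ≤ s) :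
    Real.exp ((η - 1) * (x + s * c) - s * Real.log η) ≤
      Real.exp (Real.log η * (η * x - (1 - c * η) * s)) := by
  have hη0 : 0 < η := by linarith
  have h1 : η - 1 ≤ η * Real.log η := by
    have h := Real.one_sub_inv_le_log_of_pos hη0
    have h2 := mul_le_mul_of_nonneg_left h hη0.le
    rwa [mul_sub, mul_one, mul_inv_cancel₀ hη0.ne'] at h2
  have h2 := mul_le_mul_of_nonneg_right h1 (add_nonneg hx (mul_nonneg hs hc))
  refine Real.exp_le_exp.2 ?_
  linarith

/-- Multiply the two bounds on `p` and take the square root. The factor `2` and the full power of `1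
- c` are slack. -/
lemma le_geometric_mean_bound {p x c e : ℝ} (hx : 0 ≤ x) (hc : 0 ≤ c) (hc1 : c < 1)
    (h1 : (1 - c) * p ≤ x) (h2 : p ≤ Real.exp e) (hp : 0 ≤ p) :
    p ≤ 2 * √x / (1 - c) * Real.exp (e / 2) := by
  have hc' : 0 < 1 - c := by linarith
  refine le_of_sq_le_sq ?_ (by positivity)
  have hexp : Real.exp (e / 2) ^ 2 = Real.exp e := by
    rw [← Real.exp_nat_mul]
    congr 1
    push_cast
    ring
  rw [mul_pow, div_pow, mul_pow, Real.sq_sqrt hx, hexp]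
  have h3 : p ≤ 2 ^ 2 * x / (1 - c) ^ 2 := by
    rw [le_div_iff₀ (by positivity)]
    nlinarith [mul_le_mul_of_nonneg_right h1 hc'.le]
  rw [sq p]
  exact mul_le_mul h3 h2 hp (by positivity)

namespace EventSequence

variable {T : ℝ} {Ω : Type*} [MeasurableSpace Ω]

lemma IsLinearHawkes.measureReal_le_count_le {P : Measure Ω} [IsProbabilityMeasure P]
    {S : EventSequence T Ω} {B c : ℝ} {lam0 mu : ℝ → ℝ} (hS : S.IsLinearHawkes P lam0 mu)
    (hT : 0 < T) (hB : 0 ≤ B) (hlam : ∀ᵐ t ∂(volume.restrict (Icc 0 T)), lam0 t ≤ B)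
    (hmu0 : ∀ t ∈ Icc 0 T, 0 ≤ mu t) (hmui : IntegrableOn mu (Icc 0 T))
    (hc : ∫ t in Icc 0 T, mu t = c) (hc1 : c < 1) {η : ℝ} (hη : 1 < η) {s : ℕ} (hs : 1 ≤ s) :
    P.real {ω | s ≤ S.count ω} ≤ 2 * √(B * T) / (1 - c) *
      Real.exp (Real.log η / 2 * (η * (B * T) - (1 - c * η) * s)) := by
  -- The kernel `g` is `mu` cut off outside `[0, T]`: integrable on the line, zero at negative
  -- times, and of total mass `c`.
  have hg0 : ∀ t, 0 ≤ (Icc 0 T).indicator mu t := fun t => indicator_nonneg hmu0 t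
  have hgi : Integrable ((Icc 0 T).indicator mu) :=
    (integrable_indicator_iff measurableSet_Icc).2 hmui
  have hgneg : ∀ t < 0, (Icc 0 T).indicator mu t = 0 := fun t ht =>
    indicator_of_notMem (fun h => absurd h.1 (not_le.2 ht)) _
  have hmug : ∀ t ∈ Icc 0 T, mu t ≤ (Icc 0 T).indicator mu t := fun t ht =>
    (indicator_of_mem ht mu).ge
  have hgc : ∫ u, (Icc 0 T).indicator mu u = c := by
    rw [integral_indicator measurableSet_Icc, hc]
  have hc0 : 0 ≤ c := hgc ▸ integral_nonneg hg0
  have h1 := hS.measureReal_one_le_count_le hT hB hlam hg0 hgi hgneg hmug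
  have h2 := hS.measureReal_le_count_le_exp hT hB hlam hg0 hgi hgneg hmug s hη
  rw [hgc] at h1 h2
  have hBT : 0 ≤ B * T := mul_nonneg hB hT.le
  have hmono : P.real {ω | s ≤ S.count ω} ≤ P.real {ω | 1 ≤ S.count ω} :=
    measureReal_mono fun ω (hω : s ≤ S.count ω) => hs.trans hω
  have h3 := le_geometric_mean_bound hBT hc0 hc1
    ((mul_le_mul_of_nonneg_left hmono (by linarith)).trans h1)
    (h2.trans (exp_sub_one_mul_le hη hBT hc0 (Nat.cast_nonneg s))) measureReal_nonneg
  rwa [mul_div_right_comm (Real.log η)] at h3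

/-- Union bound: `M` is the value of `s` at which `n` times the tail bound equals `δ`. An integer
threshold `s ≥ 1` is used because the tail bound is available only there. -/
lemma IsLinearHawkes.one_sub_le_measureReal_sup_count_lt {P : Measure Ω}
    [IsProbabilityMeasure P] {B c : ℝ} {lam0 mu : ℝ → ℝ} {n : ℕ} (hn : 1 ≤ n)
    {S : Fin n → EventSequence T Ω} (hS : ∀ i, (S i).IsLinearHawkes P lam0 mu)
    (hT : 0 < T) (hB : 0 < B) (hlam : ∀ᵐ t ∂(volume.restrict (Icc 0 T)), lam0 t ≤ B)
    (hmu0 : ∀ t ∈ Icc 0 T, 0 ≤ mu t) (hmui : IntegrableOn mu (Icc 0 T))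
    (hc : ∫ t in Icc 0 T, mu t = c) (hc1 : c < 1) {η : ℝ} (hη : 1 < η) (hcη : c * η < 1)
    {δ : ℝ} (hδ : 0 < δ) {M : ℝ} (hM : M = 1 / (1 - c * η) *
      (2 / Real.log η * Real.log (2 * n * √(B * T) / (δ * (1 - c))) + η * (B * T)))
    {s : ℕ} (hs : 1 ≤ s) (hMs : M ≤ s) :
    1 - δ ≤ P.real {ω | Finset.univ.sup (fun i => (S i).count ω) < s} := by
  have hn0 : (0 : ℝ) < n := by exact_mod_cast hn
  have hc' : 0 < 1 - c := by linarith
  have hcη' : 0 < 1 - c * η := by linarith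
  have hlog : 0 < Real.log η := Real.log_pos hη
  have hsqrt : 0 < √(B * T) := Real.sqrt_pos.2 (mul_pos hB hT)
  have hbound : n * (2 * √(B * T) / (1 - c) *
      Real.exp (Real.log η / 2 * (η * (B * T) - (1 - c * η) * s))) ≤ δ := by
    have hexp : Real.log η / 2 * (η * (B * T) - (1 - c * η) * s) ≤
        -Real.log (2 * n * √(B * T) / (δ * (1 - c))) := by
      have h1 := mul_le_mul_of_nonneg_left hMs hcη'.le
      have h2 : (1 - c * η) * M =
          2 / Real.log η * Real.log (2 * n * √(B * T) / (δ * (1 - c))) + η * (B * T) := by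
        rw [hM, ← mul_assoc, mul_one_div_cancel hcη'.ne', one_mul]
      have h3 : η * (B * T) - (1 - c * η) * s ≤
          -(2 / Real.log η * Real.log (2 * n * √(B * T) / (δ * (1 - c)))) := by linarith
      refine (mul_le_mul_of_nonneg_left h3 (half_pos hlog).le).trans_eq ?_
      field_simp
    have hle := Real.exp_le_exp.2 hexp
    rw [Real.exp_neg, Real.exp_log (by positivity)] at hle
    calc _ ≤ n * (2 * √(B * T) / (1 - c) * (2 * n * √(B * T) / (δ * (1 - c)))⁻¹) := by gcongr
      _ = δ := by field_simp
  have hcompl : {ω | Finset.univ.sup (fun i => (S i).count ω) < s}ᶜ =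
      ⋃ i, {ω | s ≤ (S i).count ω} := by
    ext ω
    have hs0 : (⊥ : ℕ) < s := hs
    simp [Finset.sup_lt_iff hs0]
  have hmeas : MeasurableSet {ω | Finset.univ.sup (fun i => (S i).count ω) < s} := by
    rw [← MeasurableSet.compl_iff, hcompl]
    exact MeasurableSet.iUnion fun i => (S i).measurableSet_le_count s
  have hunion : P.real {ω | Finset.univ.sup (fun i => (S i).count ω) < s}ᶜ ≤ δ := by
    rw [hcompl]
    calc _ ≤ ∑ i, P.real {ω | s ≤ (S i).count ω} := measureReal_iUnion_fintype_le _
      _ ≤ ∑ _i : Fin n, 2 * √(B * T) / (1 - c) *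
          Real.exp (Real.log η / 2 * (η * (B * T) - (1 - c * η) * s)) :=
        Finset.sum_le_sum fun i _ =>
          (hS i).measureReal_le_count_le hT hB.le hlam hmu0 hmui hc hc1 hη hs
      _ ≤ δ := by simpa using hbound
  rw [probReal_compl_eq_one_sub hmeas] at hunion
  linarith

end EventSequence

theorem lemma2 {Ω : Type*} [MeasurableSpace Ω] (P : Measure Ω) [IsProbabilityMeasure P]
    (T B₀ cμ : ℝ) (hT : 0 < T) (hB₀ : 0 < B₀)
    (lam0 mu : ℝ → ℝ) (hlam0_meas : Measurable lam0) (hmu_meas : Measurable mu)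
    (hlam0_nonneg : ∀ t ∈ Icc 0 T, 0 ≤ lam0 t) (hmu_nonneg : ∀ t ∈ Icc 0 T, 0 ≤ mu t)
    (hlam0_le : ∀ᵐ t ∂(volume.restrict (Icc 0 T)), lam0 t ≤ B₀)
    (hmu_int : IntegrableOn mu (Icc 0 T)) (hmu_eq : ∫ t in Icc 0 T, mu t = cμ) (hcμ : cμ < 1) :
    -- the maximal number of events over `n` sequences
    (∀ η : ℝ, 1 < η → cμ * η < 1 →
      ∀ n : ℕ, 1 ≤ n → ∀ S : Fin n → EventSequence T Ω, (∀ i, (S i).IsLinearHawkes P lam0 mu) →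
      ∀ δ : ℝ, 0 < δ → δ < 1 →
      ∀ M : ℝ, M = 1 / (1 - cμ * η) *
          (2 / Real.log η * Real.log (2 * n * √(B₀ * T) / (δ * (1 - cμ))) + η * (B₀ * T)) →
        (0 < M →
          1 - δ ≤ P.real {ω | ((Finset.univ.sup (fun i => (S i).count ω) : ℕ) : ℝ) < M}) ∧
        (M ≤ 0 →
          1 - δ ≤ P.real {ω | Finset.univ.sup (fun i => (S i).count ω) = 0})) ∧
    -- the tail of the number of events of one sequence
    (∀ S : EventSequence T Ω, S.IsLinearHawkes P lam0 mu →
      ∀ η : ℝ, 1 < η → cμ * η < 1 → ∀ s : ℕ, 1 ≤ s →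
        P.real {ω | S.count ω = s} ≤ P.real {ω | s ≤ S.count ω} ∧
        P.real {ω | s ≤ S.count ω} ≤
          2 * √(B₀ * T) / (1 - cμ) *
            Real.exp (Real.log η / 2 * (η * (B₀ * T) - (1 - cμ * η) * s))) ∧
    -- the same tail bound in the form `aN * exp (-cN * s)`
    (∀ S : EventSequence T Ω, S.IsLinearHawkes P lam0 mu →
      ∀ η₀ : ℝ, 1 < η₀ → cμ * η₀ < 1 →
      ∀ aN cN : ℝ,
        aN = 2 * √(B₀ * T) * Real.exp (Real.log η₀ * η₀ * (B₀ * T) / 2) / (1 - cμ) →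
        cN = Real.log η₀ * (1 - cμ * η₀) / 2 →
        ∀ s : ℕ, 1 ≤ s →
          P.real {ω | S.count ω = s} ≤ P.real {ω | s ≤ S.count ω} ∧
          P.real {ω | s ≤ S.count ω} ≤ aN * Real.exp (-cN * s)) := by
  have htail : ∀ S : EventSequence T Ω, S.IsLinearHawkes P lam0 mu →
      ∀ η : ℝ, 1 < η → cμ * η < 1 → ∀ s : ℕ, 1 ≤ s →
        P.real {ω | S.count ω = s} ≤ P.real {ω | s ≤ S.count ω} ∧
        P.real {ω | s ≤ S.count ω} ≤ 2 * √(B₀ * T) / (1 - cμ) *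
          Real.exp (Real.log η / 2 * (η * (B₀ * T) - (1 - cμ * η) * s)) :=
    fun S hS η hη _ s hs => ⟨measureReal_mono fun ω (hω : S.count ω = s) => hω.ge,
      hS.measureReal_le_count_le hT hB₀.le hlam0_le hmu_nonneg hmu_int hmu_eq hcμ hη hs⟩
  refine ⟨fun η hη hcη n hn S hS δ hδ _ M hM => ⟨fun _ => ?_, fun hM0 => ?_⟩, htail,
    fun S hS η hη hcη aN cN haN hcN s hs => ?_⟩
  -- Use the threshold `⌈M⌉₊`: a natural number lies below it exactly when it lies below `M`.
  · have h := EventSequence.IsLinearHawkes.one_sub_le_measureReal_sup_count_lt hn hS hT hB₀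
      hlam0_le hmu_nonneg hmu_int hmu_eq hcμ hη hcη hδ hM (Nat.one_le_ceil_iff.2 ‹0 < M›)
      (Nat.le_ceil M)
    simpa only [Nat.lt_ceil] using h
  -- Here the least admissible threshold `s = 1` already exceeds `M`.
  · have h := EventSequence.IsLinearHawkes.one_sub_le_measureReal_sup_count_lt hn hS hT hB₀
      hlam0_le hmu_nonneg hmu_int hmu_eq hcμ hη hcη hδ hM le_rfl
      (hM0.trans (Nat.cast_nonneg _))
    simpa only [Nat.lt_one_iff] using h
  · have h := htail S hS η hη hcη s hs
    refine ⟨h.1, h.2.trans_eq ?_⟩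
    have hsplit : Real.log η / 2 * (η * (B₀ * T) - (1 - cμ * η) * s) =
        Real.log η * η * (B₀ * T) / 2 + -cN * s := by
      rw [hcN]
      ring
    rw [hsplit, Real.exp_add, haN]
    ring
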